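/- Let $G$ be a connected (real, finite-dimensional, smooth) Lie group with identity $e$, Lie algebra $\mathfrak g=T_eG$ and exponential map $\exp:\mathfrak g\to G$. (1) Assume $\dim G\ge 1$. Let $P(\mathfrak g)$ be the projective space of lines through the origin in $\mathfrak g$, and let $\sigma:P(\mathfrak g)\to G$ be a continuous map (an unoriented Kakeya line configuration) which is linear, i.e. there is a continuous map $\mu:P(\mathfrak g)\to\mathfrak g$ with $\exp\circ\mu=\sigma$. Then $e$ belongs to $$|\sigma|=\bigcup_{L\in P(\mathfrak g)}\sigma(L)\,\exp(L).$$ (2) Assume $\dim G$ is odd. Fix any positive definite inner product on $\mathfrak g$, with unit sphere $S(\mathfrak g)$, and let $\sigma:S(\mathfrak g)\to G$ be a continuous map (an oriented Kakeya line configuration) which is linear, i.e. there is a continuous map $\mu:S(\mathfrak g)\to\mathfrak g$ with $\exp\circ\mu=\sigma$. Then $e$ belongs to $$|\sigma|=\bigcup_{x\in S(\mathfrak g)}\sigma(x)\,\exp(\mathbb R x).$$ -/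

import Mathlib

open scoped Manifold ContDiff LinearAlgebra.Projectivization

namespace Kakeya

/-- The projectivization `ℙ K V` of a topological vector space carries the quotient topology
from `V ∖ {0}`. -/
instance instTopologicalSpaceProjectivization (K V : Type*) [DivisionRing K] [AddCommGroup V]
    [Module K V] [TopologicalSpace V] : TopologicalSpace (ℙ K V) :=
  inferInstanceAs (TopologicalSpace (Quotient (projectivizationSetoid K V)))

section LieGroup

variable {E : Type*} [NormedAddCommGroup E] [NormedSpace ℝ E]
  {H : Type*} [TopologicalSpace H] {I : ModelWithCorners ℝ E H}
  {G : Type*} [TopologicalSpace G] [ChartedSpace H G] [Group G]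

/-- A Lie group is Hausdorff. -/
theorem t2Space_of_lieGroup [LieGroup I ∞ G] : T2Space G := by
  have : IsTopologicalGroup G := topologicalGroup_of_lieGroup I ∞
  have : T1Space G := I.t1Space G
  infer_instance

/-- Left-invariant vector fields are `C^1`. -/
theorem contMDiff_invariantField [LieGroup I ∞ G] (v : GroupLieAlgebra I G) :
    ContMDiff I I.tangent 1
      (fun g : G ↦ (⟨g, mulInvariantVectorField v g⟩ : TangentBundle I G)) := by
  have : LieGroup I (minSmoothness ℝ 3) G := LieGroup.of_le (n := ∞)
    (by simpa using WithTop.coe_le_coe.2 (le_top : (3 : ℕ∞) ≤ ⊤))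
  exact (contMDiff_mulInvariantVectorField v).of_le (by simp)

/-- Left translates of integral curves of a left-invariant vector field are integral curves. -/
theorem isMIntegralCurveOn_const_mul [LieGroup I ∞ G] {v : GroupLieAlgebra I G} {γ : ℝ → G}
    {s : Set ℝ} (hγ : IsMIntegralCurveOn γ (mulInvariantVectorField v) s) (g : G) :
    IsMIntegralCurveOn (fun t ↦ g * γ t) (mulInvariantVectorField v) s := by
  intro t ht
  have hd : ∀ a b : G, MDifferentiableAt I I (a * ·) b := fun a b ↦
    (contMDiff_mul_left (I := I) (n := ∞) (a := a)).mdifferentiableAt (by simp)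
  have hc : mulInvariantVectorField v (g * γ t)
      = mfderiv I I (g * ·) (γ t) (mulInvariantVectorField v (γ t)) := by
    have h1 : (fun x : G ↦ g * γ t * x) = (g * ·) ∘ (γ t * ·) := by
      ext x; simp [mul_assoc]
    have h2 := mfderiv_comp (I := I) (I' := I) (I'' := I) (1 : G)
      (g := (g * ·)) (f := (γ t * ·)) (hd _ _) (hd _ _)
    rw [← h1] at h2
    have h3 := congrArg (fun L ↦ L v) h2
    have h4 : ∀ a : G, a = γ t →
        (mfderiv I I (g * ·) a : E →L[ℝ] E) = mfderiv I I (g * ·) (γ t) := by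
      rintro a rfl
      rfl
    refine h3.trans ?_
    exact congrArg (fun L : E →L[ℝ] E ↦ L (mfderiv I I (γ t * ·) (1 : G) v)) (h4 _ (mul_one _))
  have h := (hd g (γ t)).hasMFDerivAt.comp_hasMFDerivWithinAt t (hγ t ht)
  refine h.congr_mfderiv ?_
  refine ContinuousLinearMap.ext fun (a : ℝ) ↦ ?_
  exact ((mfderiv I I (g * ·) (γ t) : E →L[ℝ] E).map_smul a _).trans
    (congrArg (fun w : E ↦ a • w) hc.symm)

/-- Every element of the Lie algebra generates a global integral curve through the identity. -/
theorem exists_oneParam [FiniteDimensional ℝ E] [BoundarylessManifold I G] [LieGroup I ∞ G]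
    (v : GroupLieAlgebra I G) :
    ∃ γ : ℝ → G, γ 0 = 1 ∧ IsMIntegralCurve γ (mulInvariantVectorField v) := by
  have : CompleteSpace E := FiniteDimensional.complete ℝ E
  have : T2Space G := t2Space_of_lieGroup (I := I)
  have : IsManifold I 1 G := IsManifold.of_le (n := ∞) (by simp)
  obtain ⟨γ, h0, hγ⟩ := exists_isMIntegralCurveAt_of_contMDiffAt_boundaryless (I := I)
    (x₀ := (1 : G)) 0 (contMDiff_invariantField v).contMDiffAt
  obtain ⟨ε, hε, hγ⟩ := isMIntegralCurveAt_iff'.mp hγ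
  refine exists_isMIntegralCurve_of_isMIntegralCurveOn (contMDiff_invariantField v) hε
    (fun x ↦ ⟨fun t ↦ x * γ t, by simp [h0], ?_⟩) 1
  refine isMIntegralCurveOn_const_mul (hγ.mono ?_) x
  simp [Real.ball_eq_Ioo]

/-- The one-parameter subgroup `t ↦ exp (t v)`: the integral curve through the identity of the
left-invariant vector field with value `v` at the identity. -/
noncomputable def oneParam [FiniteDimensional ℝ E] [BoundarylessManifold I G] [LieGroup I ∞ G]
    (v : GroupLieAlgebra I G) : ℝ → G :=
  Classical.choose (exists_oneParam v)

/-- The exponential map `exp : 𝔤 → G` of a Lie group. -/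
noncomputable def lieExp [FiniteDimensional ℝ E] [BoundarylessManifold I G] [LieGroup I ∞ G]
    (v : GroupLieAlgebra I G) : G :=
  oneParam v 1

variable [FiniteDimensional ℝ E] [BoundarylessManifold I G] [LieGroup I ∞ G]

/-- The defining property determines the one-parameter subgroup. -/
theorem eq_oneParam {v : GroupLieAlgebra I G} {γ : ℝ → G} (h0 : γ 0 = 1)
    (hγ : IsMIntegralCurve γ (mulInvariantVectorField v)) : γ = oneParam v := by
  have : T2Space G := t2Space_of_lieGroup (I := I)
  have : IsManifold I 1 G := IsManifold.of_le (n := ∞) (by simp)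
  have h := Classical.choose_spec (exists_oneParam v)
  exact isMIntegralCurve_Ioo_eq_of_contMDiff_boundaryless (t₀ := 0)
    (contMDiff_invariantField v) hγ h.2 (h0.trans h.1.symm)

/-- The underlying set `|σ| = ⋃_L σ(L) exp(L)` of an unoriented configuration `σ : P(𝔤) → G`. -/
def unorientedUnderlying (σ : C(ℙ ℝ (GroupLieAlgebra I G), G)) : Set G :=
  ⋃ L : ℙ ℝ (GroupLieAlgebra I G), 
    (fun v : GroupLieAlgebra I G ↦ σ L * lieExp v) '' (L.submodule : Set (GroupLieAlgebra I G))

/-- An unoriented configuration is linear if it lifts continuously through `exp`. -/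
def IsLinearUnoriented (σ : C(ℙ ℝ (GroupLieAlgebra I G), G)) : Prop :=
  ∃ μ : C(ℙ ℝ (GroupLieAlgebra I G), GroupLieAlgebra I G), ∀ L, lieExp (μ L) = σ L

/-- The unit sphere `S(𝔤)` of the bilinear form `B` on the Lie algebra. -/
def unitSphere (B : LinearMap.BilinForm ℝ (GroupLieAlgebra I G)) : Set (GroupLieAlgebra I G) :=
  {x | B x x = 1}

variable {B : LinearMap.BilinForm ℝ (GroupLieAlgebra I G)}

/-- The underlying set `|σ| = ⋃_x σ(x) exp(ℝ x)` of an oriented configuration `σ : S(𝔤) → G`. -/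
def orientedUnderlying (σ : C(unitSphere B, G)) : Set G :=
  ⋃ x : unitSphere B, Set.range (fun t : ℝ ↦ σ x * lieExp (t • (x : GroupLieAlgebra I G)))

/-- An oriented configuration is linear if it lifts continuously through `exp`. -/
def IsLinearOriented (σ : C(unitSphere B, G)) : Prop :=
  ∃ μ : C(unitSphere B, GroupLieAlgebra I G), ∀ x, lieExp (μ x) = σ x

end LieGroup

end Kakeya

open MeasureTheory Set Metric Filter Topology

namespace Kakeya

section Degree

variable {V : Type*} [NormedAddCommGroup V] [NormedSpace ℝ V] [FiniteDimensional ℝ V]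

@[simp]
theorem _root_.ContinuousLinearMap.det_one {V : Type*} [NormedAddCommGroup V] [NormedSpace ℝ V] :
    (1 : V →L[ℝ] V).det = 1 :=
  LinearMap.det_id

theorem exists_polynomial_det_one_add_smul (A : V →L[ℝ] V) :
    ∃ p : Polynomial ℝ, p.natDegree ≤ Module.finrank ℝ V ∧
      ∀ t : ℝ, p.eval t = (1 + t • A).det := by
  classical
  let b := Module.finBasis ℝ V
  let N := LinearMap.toMatrix b b (A : V →ₗ[ℝ] V)
  refine ⟨((Polynomial.X : Polynomial ℝ) • N.map Polynomial.C
    + (1 : Matrix _ _ ℝ).map Polynomial.C).det, ?_, fun t ↦ ?_⟩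
  · simpa using Polynomial.natDegree_det_X_add_C_le N 1
  · rw [← Polynomial.coe_evalRingHom, RingHom.map_det]
    have h : ((1 + t • A : V →L[ℝ] V) : V →ₗ[ℝ] V) = 1 + t • (A : V →ₗ[ℝ] V) := rfl
    rw [ContinuousLinearMap.det, h, ← LinearMap.det_toMatrix b,
      map_add (LinearMap.toMatrix b b), map_smul (LinearMap.toMatrix b b), LinearMap.toMatrix_one]
    congr 1
    ext i j
    simp [N, Matrix.one_apply, apply_ite, add_comm, mul_comm t]

theorem exists_interpolation_det_one_add_smul (s : Finset ℝ)
    (hs : Module.finrank ℝ V < s.card) :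
    ∃ c : ℝ → ℝ, ∀ A : V →L[ℝ] V, (1 + A).det - 1 = ∑ t ∈ s, c t * ((1 + t • A).det - 1) := by
  classical
  refine ⟨fun t ↦ (Lagrange.basis s id t).eval 1, fun A ↦ ?_⟩
  obtain ⟨p, hp, hpe⟩ := exists_polynomial_det_one_add_smul A
  have h := Lagrange.eq_interpolate (s := s) (v := id) (f := p - 1) (injOn_id _) ?_
  · have h' := congrArg (Polynomial.eval 1) h
    rw [Lagrange.interpolate_apply, Polynomial.eval_finsetSum] at h'
    simp only [Polynomial.eval_sub, hpe, Polynomial.eval_one, Polynomial.eval_mul,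
      Polynomial.eval_C, one_smul, id] at h'
    rw [h']
    exact Finset.sum_congr rfl fun t _ ↦ mul_comm _ _
  · refine lt_of_le_of_lt Polynomial.degree_le_natDegree ?_
    have : (p - 1).natDegree ≤ Module.finrank ℝ V :=
      (Polynomial.natDegree_sub_le _ _).trans (by simpa using hp)
    exact_mod_cast lt_of_le_of_lt this hs

theorem det_one_add_pos {A : V →L[ℝ] V} (hA : ‖A‖ < 1) : 0 < (1 + A).det := by
  have hne : ∀ s ∈ Icc (0 : ℝ) 1, (1 + s • A).det ≠ 0 := by
    intro s hs h0
    obtain ⟨v, hv, hv0⟩ := (Submodule.ne_bot_iff _).1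
      (LinearMap.bot_lt_ker_of_det_eq_zero (f := ((1 + s • A : V →L[ℝ] V) : V →ₗ[ℝ] V)) h0).ne'
    have h1 : v + s • A v = 0 := by simpa using hv
    have h2 : ‖v‖ = s * ‖A v‖ := by
      rw [← Real.norm_of_nonneg hs.1, ← norm_smul, ← norm_neg (s • A v),
        ← eq_neg_of_add_eq_zero_left h1]
    have h3 : ‖A v‖ ≤ ‖A‖ * ‖v‖ := A.le_opNorm v
    have h4 : 0 < ‖v‖ := norm_pos_iff.2 hv0
    nlinarith [hs.1, hs.2, norm_nonneg (A v)]
  have hc : Continuous fun s : ℝ ↦ (1 + s • A).det :=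
    ContinuousLinearMap.continuous_det.comp (by fun_prop)
  by_contra! hle
  obtain ⟨s, hs, hs0⟩ := intermediate_value_Icc' (zero_le_one (α := ℝ)) hc.continuousOn
    (show (0 : ℝ) ∈ Icc _ _ from ⟨by simpa using hle, by simp⟩)
  exact hne s hs hs0

section Haar

variable [MeasurableSpace V] [BorelSpace V] (μ : Measure V) [μ.IsAddHaarMeasure]

theorem integral_det_one_add_fderiv_sub_one_of_lipschitz {g : V → V} (hg : ContDiff ℝ 1 g)
    (hgs : HasCompactSupport g) {C : NNReal} (hC : LipschitzWith C g) (hC1 : C < 1) :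
    ∫ x, ((1 + fderiv ℝ g x).det - 1) ∂μ = 0 := by
  obtain ⟨R, hR⟩ := hgs.isCompact.isBounded.subset_closedBall (0 : V)
  have hout : ∀ x, x ∉ closedBall (0 : V) R → g x = 0 := fun x hx ↦
    image_eq_zero_of_notMem_tsupport fun h ↦ hx (hR h)
  have hout' : ∀ x, x ∉ closedBall (0 : V) R → fderiv ℝ g x = 0 := fun x hx ↦ by
    by_contra h
    exact hx (hR (support_fderiv_subset ℝ h))
  set F : V → V := fun x ↦ x + g x with hF
  have hFd : ∀ x, HasFDerivAt F (1 + fderiv ℝ g x) x := fun x ↦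
    (hasFDerivAt_id x).add ((hg.differentiable (by simp)) x).hasFDerivAt
  have happ : ApproximatesLinearOn F ((ContinuousLinearEquiv.refl ℝ V : V ≃L[ℝ] V) : V →L[ℝ] V)
      univ C := by
    refine LipschitzOnWith.approximatesLinearOn ?_ |>.mono_num le_rfl
    refine LipschitzWith.lipschitzOnWith ?_
    convert hC using 1
    ext x
    simp [hF]
  have hc : Subsingleton V ∨ C < ‖((ContinuousLinearEquiv.refl ℝ V).symm : V →L[ℝ] V)‖₊⁻¹ := by
    rcases subsingleton_or_nontrivial V with h | h
    · exact Or.inl h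
    · right
      have : ‖((ContinuousLinearEquiv.refl ℝ V).symm : V →L[ℝ] V)‖₊ = 1 := by
        ext
        exact ContinuousLinearMap.norm_id
      rwa [this, inv_one]
  have hinj : Function.Injective F := (happ.toHomeomorph F hc).injective
  have hsurj : Function.Surjective F := (happ.toHomeomorph F hc).surjective
  have himage : F '' closedBall 0 R = closedBall 0 R := by
    refine Subset.antisymm ?_ fun y hy ↦ ?_
    · rintro _ ⟨x, hx, rfl⟩
      by_contra h
      have h1 : F (F x) = F x := by
        simp only [hF] at h ⊢
        rw [hout _ h, add_zero]
      rw [hinj h1] at h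
      exact h hx
    · obtain ⟨x, rfl⟩ := hsurj y
      refine ⟨x, ?_, rfl⟩
      by_contra h
      have : F x = x := by simp [hF, hout x h]
      rw [this] at hy
      exact h hy
  have hcv := integral_image_eq_integral_abs_det_fderiv_smul μ
    (measurableSet_closedBall (x := (0 : V)) (ε := R))
    (fun x _ ↦ (hFd x).hasFDerivWithinAt) hinj.injOn (fun _ ↦ (1 : ℝ))
  rw [himage] at hcv
  have hpos : ∀ x, 0 < (1 + fderiv ℝ g x).det := fun x ↦
    det_one_add_pos (lt_of_le_of_lt (norm_fderiv_le_of_lipschitz ℝ hC) (by exact_mod_cast hC1))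
  have hcont : Continuous fun x ↦ (1 + fderiv ℝ g x).det :=
    ContinuousLinearMap.continuous_det.comp
      (continuous_const.add (hg.continuous_fderiv (by simp)))
  rw [← setIntegral_eq_integral_of_forall_compl_eq_zero (s := closedBall (0 : V) R)
    (fun x hx ↦ by simp [hout' x hx]), integral_sub, hcv]
  · simp [abs_of_pos (hpos _)]
  · exact hcont.continuousOn.integrableOn_compact (isCompact_closedBall _ _)
  · exact continuousOn_const.integrableOn_compact (isCompact_closedBall _ _)

/-- A `C^1` self-map that is the identity outside a compact set has total Jacobian excess zero. -/
theorem integral_det_one_add_fderiv_sub_one {g : V → V} (hg : ContDiff ℝ 1 g)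
    (hgs : HasCompactSupport g) :
    ∫ x, ((1 + fderiv ℝ g x).det - 1) ∂μ = 0 := by
  obtain ⟨C, hC⟩ := hg.lipschitzWith_of_hasCompactSupport hgs (by simp)
  obtain ⟨s, hs, hcard⟩ := (Ioo_infinite (a := (0 : ℝ)) (b := (C + 1 : ℝ)⁻¹)
    (by positivity)).exists_subset_card_eq (Module.finrank ℝ V + 1)
  obtain ⟨c, hc⟩ := exists_interpolation_det_one_add_smul (V := V) s (by omega)
  have hcont : ∀ t : ℝ, Continuous fun x ↦ ((1 + t • fderiv ℝ g x).det - 1) := fun t ↦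
    (ContinuousLinearMap.continuous_det.comp
      ((continuous_const (y := (1 : V →L[ℝ] V))).add
        ((hg.continuous_fderiv (by simp)).const_smul t))).sub continuous_const
  have hsupp : ∀ t : ℝ, HasCompactSupport fun x ↦ ((1 + t • fderiv ℝ g x).det - 1) := fun t ↦
    (hgs.fderiv ℝ).comp_left (g := fun A : V →L[ℝ] V ↦ (1 + t • A).det - 1) (by simp)
  rw [integral_congr_ae (ae_of_all _ fun x ↦ hc (fderiv ℝ g x))]
  rw [integral_finsetSum _ fun t _ ↦
    ((hcont t).integrable_of_hasCompactSupport (hsupp t)).const_mul _]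
  refine Finset.sum_eq_zero fun t ht ↦ ?_
  rw [integral_const_mul]
  have ht' := hs ht
  have htC : Real.toNNReal t * C < 1 := by
    rw [← NNReal.coe_lt_coe, NNReal.coe_mul, Real.coe_toNNReal _ ht'.1.le]
    have h1 : t * (C + 1) < 1 := by
      have := mul_lt_mul_of_pos_right ht'.2 (show (0 : ℝ) < C + 1 by positivity)
      rwa [inv_mul_cancel₀ (by positivity)] at this
    push_cast
    nlinarith [ht'.1]
  have hL : LipschitzWith (Real.toNNReal t * C) (t • g) := by
    have h := (lipschitzWith_smul (β := V) t).comp hC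
    rwa [Real.nnnorm_of_nonneg ht'.1.le, ← Real.toNNReal_of_nonneg] at h
  have := integral_det_one_add_fderiv_sub_one_of_lipschitz μ (g := t • g) (hg.const_smul t)
    (hgs.smul_left (f := fun _ ↦ t)) hL htC
  simp_rw [show ∀ x, t • fderiv ℝ g x = fderiv ℝ (t • g) x from fun x ↦
    (fderiv_const_smul ((hg.differentiable (by simp)) x) t).symm]
  rw [this, mul_zero]

end Haar

theorem det_one_add_smulRight (ℓ : V →L[ℝ] ℝ) (w : V) :
    (1 + ℓ.smulRight w : V →L[ℝ] V).det = 1 + ℓ w :=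
  LinearMap.transvection.det (ℓ : V →ₗ[ℝ] ℝ) w

theorem hasCompactSupport_comp_add {V : Type*} [NormedAddCommGroup V] {g : V → V}
    (hgs : HasCompactSupport g) {φ : V → ℝ} (hφ : HasCompactSupport φ) :
    HasCompactSupport fun x ↦ φ (x + g x) := by
  refine HasCompactSupport.intro (hgs.isCompact.union hφ.isCompact) fun x hx ↦ ?_
  rw [mem_union, not_or] at hx
  rw [image_eq_zero_of_notMem_tsupport hx.1, add_zero, image_eq_zero_of_notMem_tsupport hx.2]

section Integrable

variable {V : Type*} [NormedAddCommGroup V] [NormedSpace ℝ V] [MeasurableSpace V] [BorelSpace V]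
  (μ : Measure V) [IsFiniteMeasureOnCompacts μ]

theorem integrable_det_one_add_fderiv_sub_one {g : V → V} (hg : ContDiff ℝ 1 g)
    (hgs : HasCompactSupport g) : Integrable (fun x ↦ (1 + fderiv ℝ g x).det - 1) μ := by
  refine Continuous.integrable_of_hasCompactSupport ?_ ?_
  · exact (ContinuousLinearMap.continuous_det.comp
      (continuous_const.add (hg.continuous_fderiv (by simp)))).sub continuous_const
  · exact (hgs.fderiv ℝ).comp_left (g := fun A : V →L[ℝ] V ↦ (1 + A).det - 1) (by simp)

theorem integrable_comp_mul_det {g : V → V} (hg : ContDiff ℝ 1 g)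
    (hgs : HasCompactSupport g) {φ : V → ℝ} (hφ : Continuous φ) (hφs : HasCompactSupport φ) :
    Integrable (fun x ↦ φ (x + g x) * (1 + fderiv ℝ g x).det) μ := by
  refine Continuous.integrable_of_hasCompactSupport ?_
    (hasCompactSupport_comp_add hgs hφs).mul_right
  exact (hφ.comp (continuous_id.add hg.continuous)).mul
    (ContinuousLinearMap.continuous_det.comp
      (continuous_const.add (hg.continuous_fderiv (by simp))))

end Integrable

section Haar

variable [MeasurableSpace V] [BorelSpace V] (μ : Measure V) [μ.IsAddHaarMeasure]

theorem integral_fderiv_comp_mul_det {g : V → V} (hg : ContDiff ℝ 1 g)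
    (hgs : HasCompactSupport g) {φ : V → ℝ} (hφ : ContDiff ℝ 1 φ) (hφs : HasCompactSupport φ)
    (w : V) :
    ∫ x, (fderiv ℝ φ (x + g x) w * (1 + fderiv ℝ g x).det - fderiv ℝ φ x w) ∂μ = 0 := by
  have hφ2 : ContDiff ℝ 1 fun x ↦ φ x • w := hφ.smul contDiff_const
  have hφ2s : HasCompactSupport fun x ↦ φ x • w := hφs.smul_right
  have hg1 : ContDiff ℝ 1 fun x ↦ g x + φ (x + g x) • w :=
    hg.add ((hφ.comp (contDiff_id.add hg)).smul contDiff_const)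
  have hg1s : HasCompactSupport fun x ↦ g x + φ (x + g x) • w :=
    hgs.add (hasCompactSupport_comp_add hgs hφs).smul_right
  have hd2 : ∀ x, (1 + fderiv ℝ (fun x ↦ φ x • w) x).det = 1 + fderiv ℝ φ x w := fun x ↦ by
    rw [fderiv_smul_const ((hφ.differentiable (by simp)) x), det_one_add_smulRight]
  have hd1 : ∀ x, (1 + fderiv ℝ (fun x ↦ g x + φ (x + g x) • w) x).det
      = (1 + fderiv ℝ φ (x + g x) w) * (1 + fderiv ℝ g x).det := fun x ↦ by
    have hgx := ((hg.differentiable (by simp)) x).hasFDerivAt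
    have hf : HasFDerivAt (fun x ↦ x + g x) (1 + fderiv ℝ g x) x := (hasFDerivAt_id x).add hgx
    have hp := ((hφ.differentiable (by simp)) (x + g x)).hasFDerivAt.comp x hf
    have h := hgx.add (hp.smul_const w)
    have h' : fderiv ℝ (fun x ↦ g x + φ (x + g x) • w) x = _ := h.fderiv
    rw [h', ← det_one_add_smulRight]
    have h2 : (1 + (fderiv ℝ g x + ((fderiv ℝ φ (x + g x)).comp (1 + fderiv ℝ g x)).smulRight w))
        = (1 + (fderiv ℝ φ (x + g x)).smulRight w).comp (1 + fderiv ℝ g x) := by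
      ext v
      simp only [add_apply, one_apply_eq_self,
        ContinuousLinearMap.smulRight_apply, ContinuousLinearMap.comp_apply, add_smul, map_add]
      abel
    rw [h2]
    exact LinearMap.det_comp _ _
  have e1 := integral_det_one_add_fderiv_sub_one μ hg1 hg1s
  have e2 := integral_det_one_add_fderiv_sub_one μ hφ2 hφ2s
  have e0 := integral_det_one_add_fderiv_sub_one μ hg hgs
  have i1 := integrable_det_one_add_fderiv_sub_one μ hg1 hg1s
  have i2 := integrable_det_one_add_fderiv_sub_one μ hφ2 hφ2s
  have i0 := integrable_det_one_add_fderiv_sub_one μ hg hgs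
  have key : ∀ x, fderiv ℝ φ (x + g x) w * (1 + fderiv ℝ g x).det - fderiv ℝ φ x w
      = ((1 + fderiv ℝ (fun x ↦ g x + φ (x + g x) • w) x).det - 1)
        - ((1 + fderiv ℝ g x).det - 1)
        - ((1 + fderiv ℝ (fun x ↦ φ x • w) x).det - 1) := fun x ↦ by
    rw [hd1, hd2]; ring
  have h := integral_sub (i1.sub i0) i2
  rw [integral_sub' i1 i0, e0, e1, e2, sub_zero, sub_zero] at h
  rw [integral_congr_ae (ae_of_all _ key), ← h]
  rfl

/-- Change of variables for a `C^1` map that is the identity outside a compact set. -/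
theorem integral_comp_mul_det_sub {g : V → V} (hg : ContDiff ℝ 1 g)
    (hgs : HasCompactSupport g) {φ : V → ℝ} (hφ : ContDiff ℝ 1 φ) (hφs : HasCompactSupport φ) :
    ∫ x, (φ (x + g x) * (1 + fderiv ℝ g x).det - φ x) ∂μ = 0 := by
  obtain ⟨R, hR⟩ := hgs.isCompact.isBounded.subset_closedBall (0 : V)
  rcases subsingleton_or_nontrivial V with hV | hV
  · have : ∀ x : V, (1 + fderiv ℝ g x).det = 1 := fun x ↦ by
      rw [Subsingleton.elim (fderiv ℝ g x) 0, add_zero, ContinuousLinearMap.det_one]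
    simp [this, fun x ↦ Subsingleton.elim (x + g x) x]
  have hdc : Continuous fun x ↦ (1 + fderiv ℝ g x).det :=
    ContinuousLinearMap.continuous_det.comp
      (continuous_const.add (hg.continuous_fderiv (by simp)))
  have hφc : Continuous (fderiv ℝ φ) := hφ.continuous_fderiv (by simp)
  have hK : IsCompact (closedBall (0 : V) R) := isCompact_closedBall _ _
  have hout : ∀ x, x ∉ closedBall (0 : V) R → g x = 0 ∧ fderiv ℝ g x = 0 := fun x hx ↦
    ⟨image_eq_zero_of_notMem_tsupport fun h ↦ hx (hR h), by
      by_contra h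
      exact hx (hR (support_fderiv_subset ℝ h))⟩
  obtain ⟨w, hw⟩ : ∃ w : V, ∀ x ∈ closedBall (0 : V) R, φ (x + g x - w) = 0 ∧ φ (x - w) = 0 := by
    obtain ⟨r, hr⟩ := hφs.isCompact.isBounded.subset_closedBall (0 : V)
    obtain ⟨r', hr'⟩ := (hK.image (continuous_id.add hg.continuous)).isBounded.subset_closedBall 0
    obtain ⟨w, hw⟩ := NormedSpace.exists_lt_norm ℝ V (r + max R r')
    have aux : ∀ y, ‖y‖ ≤ max R r' → φ (y - w) = 0 := fun y hy ↦ by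
      refine image_eq_zero_of_notMem_tsupport fun h ↦ ?_
      have h1 := mem_closedBall_zero_iff.1 (hr h)
      have h2 := norm_sub_norm_le w y
      rw [norm_sub_rev] at h2
      linarith
    refine ⟨w, fun x hx ↦ ⟨aux _ (le_max_of_le_right ?_), aux _ (le_max_of_le_left ?_)⟩⟩
    · exact mem_closedBall_zero_iff.1 (hr' ⟨x, hx, rfl⟩)
    · exact mem_closedBall_zero_iff.1 hx
  have hzero : ∀ s : ℝ, ∀ x, x ∉ closedBall (0 : V) R →
      φ (x + g x - s • w) * (1 + fderiv ℝ g x).det - φ (x - s • w) = 0 := fun s x hx ↦ by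
    simp [(hout x hx).1, (hout x hx).2]
  set K : ℝ → ℝ := fun s ↦ ∫ x in closedBall (0 : V) R,
    (φ (x + g x - s • w) * (1 + fderiv ℝ g x).det - φ (x - s • w)) ∂μ with hKdef
  have hK1 : K 1 = 0 := by
    refine setIntegral_eq_zero_of_forall_eq_zero fun x hx ↦ ?_
    simp [hw x hx]
  have hK0 : K 0 = ∫ x, (φ (x + g x) * (1 + fderiv ℝ g x).det - φ x) ∂μ := by
    rw [hKdef]
    simp only
    rw [setIntegral_eq_integral_of_forall_compl_eq_zero (hzero 0)]
    simp
  obtain ⟨C, hC⟩ : ∃ C, ∀ y, ‖fderiv ℝ φ y‖ ≤ C :=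
    hφc.bounded_above_of_compact_support (hφs.fderiv ℝ)
  obtain ⟨D, hD⟩ := hK.exists_bound_of_continuousOn hdc.continuousOn
  have hderiv : ∀ s, HasDerivAt K 0 s := by
    intro s
    have h := (hasDerivAt_integral_of_dominated_loc_of_deriv_le (𝕜 := ℝ)
      (μ := μ.restrict (closedBall (0 : V) R)) (x₀ := s) (s := univ)
      (F := fun s x ↦ φ (x + g x - s • w) * (1 + fderiv ℝ g x).det - φ (x - s • w))
      (F' := fun s x ↦ fderiv ℝ φ (x + g x - s • w) (-w) * (1 + fderiv ℝ g x).det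
        - fderiv ℝ φ (x - s • w) (-w))
      (bound := fun _ ↦ C * ‖w‖ * D + C * ‖w‖) univ_mem ?_ ?_ ?_ ?_ ?_ ?_).2
    · rw [setIntegral_eq_integral_of_forall_compl_eq_zero fun x hx ↦ by
        simp [(hout x hx).1, (hout x hx).2]] at h
      have h1 := integral_fderiv_comp_mul_det μ hg hgs (φ := fun y ↦ φ (y - s • w))
        (hφ.comp (contDiff_id.sub contDiff_const))
        (hφs.comp_homeomorph (Homeomorph.subRight (s • w))) (-w)
      simp only [fderiv_comp_sub] at h1
      rw [h1] at h
      exact h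
    · refine Eventually.of_forall fun s ↦ Continuous.aestronglyMeasurable ?_
      have := hφ.continuous
      have := hg.continuous
      fun_prop
    · refine ContinuousOn.integrableOn_compact hK ?_
      have := hφ.continuous
      have := hg.continuous
      fun_prop
    · refine Continuous.aestronglyMeasurable ?_
      have := hg.continuous
      fun_prop
    · refine (ae_restrict_mem measurableSet_closedBall).mono fun x hx s _ ↦ ?_
      have hb : ∀ y, ‖fderiv ℝ φ y (-w)‖ ≤ C * ‖w‖ := fun y ↦ by
        rw [← norm_neg w]
        exact ContinuousLinearMap.le_of_opNorm_le _ (hC y) _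
      refine (norm_sub_le _ _).trans (add_le_add ?_ (hb _))
      rw [norm_mul]
      exact mul_le_mul (hb _) (hD x hx) (norm_nonneg _) ((norm_nonneg _).trans (hb 0))
    · exact continuousOn_const.integrableOn_compact hK
    · refine ae_of_all _ fun x s _ ↦ ?_
      have hlin : ∀ y : V, HasDerivAt (fun s : ℝ ↦ φ (y - s • w))
          (fderiv ℝ φ (y - s • w) (-w)) s := fun y ↦ by
        have h1 : HasDerivAt (fun s : ℝ ↦ y - s • w) (-w) s := by
          simpa using ((hasDerivAt_id s).smul_const w).const_sub y
        exact ((hφ.differentiable (by simp)) _).hasFDerivAt.comp_hasDerivAt s h1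
      exact ((hlin _).mul_const _).sub (hlin _)
  have hconst := is_const_of_deriv_eq_zero (fun s ↦ (hderiv s).differentiableAt)
    (fun s ↦ (hderiv s).deriv) 0 1
  rw [← hK0, hconst, hK1]

theorem integral_comp_mul_det {g : V → V} (hg : ContDiff ℝ 1 g)
    (hgs : HasCompactSupport g) {φ : V → ℝ} (hφ : ContDiff ℝ 1 φ) (hφs : HasCompactSupport φ) :
    ∫ x, φ (x + g x) * (1 + fderiv ℝ g x).det ∂μ = ∫ x, φ x ∂μ := by
  rw [← sub_eq_zero, ← integral_sub (integrable_comp_mul_det μ hg hgs hφ.continuous hφs)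
    (hφ.continuous.integrable_of_hasCompactSupport hφs)]
  exact integral_comp_mul_det_sub μ hg hgs hφ hφs

end Haar

theorem exists_injOn_nhds_of_det_ne_zero {F : V → V} (hF : ContDiff ℝ 1 F) {x : V}
    (hx : (fderiv ℝ F x).det ≠ 0) :
    ∃ N : Set V, IsOpen N ∧ x ∈ N ∧ InjOn F N ∧
      (∀ z ∈ N, SignType.sign (fderiv ℝ F z).det = SignType.sign (fderiv ℝ F x).det) ∧
      ∀ U ⊆ N, IsOpen U → IsOpen (F '' U) := by
  have hs := (hF.contDiffAt (x := x)).hasStrictFDerivAt (by simp)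
  obtain ⟨e, he⟩ : ∃ e : V ≃L[ℝ] V, (e : V →L[ℝ] V) = fderiv ℝ F x :=
    ⟨(LinearEquiv.ofIsUnitDet (f := (fderiv ℝ F x : V →ₗ[ℝ] V)) (v := Module.finBasis ℝ V)
      (v' := Module.finBasis ℝ V)
      (by simpa [LinearMap.det_toMatrix] using hx)).toContinuousLinearEquiv, by ext v; rfl⟩
  rw [← he] at hs
  have hc : Continuous fun z ↦ (fderiv ℝ F z).det :=
    ContinuousLinearMap.continuous_det.comp (hF.continuous_fderiv (by simp))
  have hsign : ∀ᶠ z in 𝓝 x,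
      SignType.sign (fderiv ℝ F z).det = SignType.sign (fderiv ℝ F x).det := by
    rcases hx.lt_or_gt with h | h
    · filter_upwards [hc.continuousAt.eventually_lt_const h] with z hz
      rw [sign_neg h, sign_neg hz]
    · filter_upwards [hc.continuousAt.eventually_const_lt h] with z hz
      rw [sign_pos h, sign_pos hz]
  obtain ⟨N, hN, hNo, hxN⟩ := _root_.eventually_nhds_iff.1 hsign
  let φ := hs.toOpenPartialHomeomorph F
  have hsub : N ∩ φ.source ⊆ φ.source := inter_subset_right
  refine ⟨N ∩ φ.source, hNo.inter φ.open_source, ⟨hxN, hs.mem_toOpenPartialHomeomorph_source⟩,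
    φ.injOn.mono hsub, fun z hz ↦ hN z hz.1, fun U hU hUo ↦ ?_⟩
  exact φ.isOpen_image_of_subset_source hUo (hU.trans hsub)

theorem finite_fiber_of_det_ne_zero {F : V → V} (hF : ContDiff ℝ 1 F) {y : V}
    (hK : IsCompact (F ⁻¹' {y})) (hy : ∀ x, F x = y → (fderiv ℝ F x).det ≠ 0) :
    (F ⁻¹' {y}).Finite := by
  choose! N hNo hxN hinj _ _ using fun x (hx : F x = y) ↦
    exists_injOn_nhds_of_det_ne_zero hF (hy x hx)
  obtain ⟨t, ht, hcov⟩ := hK.elim_nhds_subcover N fun x hx ↦ (hNo x hx).mem_nhds (hxN x hx)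
  refine t.finite_toSet.subset fun z hz ↦ ?_
  obtain ⟨x, hx, hzx⟩ := mem_iUnion₂.1 (hcov hz)
  have hxy : F x = y := ht x hx
  rwa [hinj x hxy hzx (hxN x hxy) (Eq.trans hz hxy.symm)]

theorem odd_card_of_sum_sign_eq_one {α : Type*} (S : Finset α) (s : α → ℝ)
    (hs : ∀ x ∈ S, s x ≠ 0) (h : ∑ x ∈ S, ((SignType.sign (s x) : SignType) : ℝ) = 1) :
    Odd S.card := by
  have h1 : ∑ x ∈ S, ((SignType.sign (s x) : SignType) : ℤ) = 1 := by
    have : ((∑ x ∈ S, ((SignType.sign (s x) : SignType) : ℤ) : ℤ) : ℝ) = 1 := by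
      rw [← h]
      push_cast
      rfl
    exact_mod_cast this
  have h2 := congrArg (Int.cast : ℤ → ZMod 2) h1
  rw [Int.cast_sum, Finset.sum_congr rfl (g := fun _ ↦ 1)] at h2
  · rw [← ZMod.natCast_eq_one_iff_odd]
    simpa using h2
  · intro x hx
    rcases (hs x hx).lt_or_gt with h | h
    · rw [sign_neg h]; decide
    · rw [sign_pos h]; decide

/-- A regular value of a `C^1` self-map that is the identity outside a compact set has an odd
number of preimages. -/
theorem exists_finset_fiber_odd_card {g : V → V} (hg : ContDiff ℝ 1 g)
    (hgs : HasCompactSupport g) {y : V} (hy : ∀ x, x + g x = y → (1 + fderiv ℝ g x).det ≠ 0) :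
    ∃ S : Finset V, (∀ x, x ∈ S ↔ x + g x = y) ∧ Odd S.card := by
  classical
  let _ : MeasurableSpace V := borel V
  have _ : BorelSpace V := ⟨rfl⟩
  let μ : Measure V := Measure.addHaar
  set F : V → V := fun x ↦ x + g x with hFdef
  have hF : ContDiff ℝ 1 F := contDiff_id.add hg
  have hFd : ∀ x, fderiv ℝ F x = 1 + fderiv ℝ g x := fun x ↦
    ((hasFDerivAt_id x).add ((hg.differentiable (by simp)) x).hasFDerivAt).fderiv
  replace hy : ∀ x, F x = y → (fderiv ℝ F x).det ≠ 0 := fun x hx ↦ by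
    rw [hFd]; exact hy x hx
  have hout : ∀ x, x ∉ tsupport g → F x = x := fun x hx ↦ by
    simp [hFdef, image_eq_zero_of_notMem_tsupport hx]
  have hK : IsCompact (F ⁻¹' {y}) := by
    refine (hgs.isCompact.union (isCompact_singleton (x := y))).of_isClosed_subset
      (isClosed_singleton.preimage hF.continuous) fun x hx ↦ ?_
    by_cases h : x ∈ tsupport g
    · exact Or.inl h
    · exact Or.inr ((hout x h).symm.trans hx)
  have hfin := finite_fiber_of_det_ne_zero hF hK hy
  choose! N₀ hNo₀ hxN₀ hinj₀ hsign₀ hopen₀ using fun x (hx : F x = y) ↦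
    exists_injOn_nhds_of_det_ne_zero hF (hy x hx)
  obtain ⟨U, hU, hUd⟩ := hfin.t2_separation
  set S := hfin.toFinset with hS
  have hmem : ∀ x, x ∈ S ↔ F x = y := fun x ↦ by simp [hS]
  set N : V → Set V := fun x ↦ N₀ x ∩ U x with hN
  have hNo : ∀ x ∈ S, IsOpen (N x) := fun x hx ↦ (hNo₀ x ((hmem x).1 hx)).inter (hU x).2
  have hxN : ∀ x ∈ S, x ∈ N x := fun x hx ↦ ⟨hxN₀ x ((hmem x).1 hx), (hU x).1⟩
  have hdisj : (S : Set V).PairwiseDisjoint N := fun a ha b hb hab ↦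
    (hUd ((hmem a).1 ha) ((hmem b).1 hb) hab).mono inter_subset_right inter_subset_right
  obtain ⟨R, hR⟩ := hgs.isCompact.isBounded.subset_closedBall (0 : V)
  have hfar : ∀ᶠ z in 𝓝 y, ∀ x, F x = z → x ∈ ⋃ x ∈ S, N x := by
    set R' := max R (‖y‖ + 1) with hR'
    have hC : IsCompact (F '' (closedBall 0 R' \ ⋃ x ∈ S, N x)) :=
      ((isCompact_closedBall _ _).diff (isOpen_biUnion hNo)).image hF.continuous
    have hyC : y ∉ F '' (closedBall 0 R' \ ⋃ x ∈ S, N x) := by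
      rintro ⟨x, hx, hxy⟩
      exact hx.2 (mem_biUnion ((hmem x).2 hxy) (hxN x ((hmem x).2 hxy)))
    filter_upwards [hC.isClosed.isOpen_compl.mem_nhds hyC, ball_mem_nhds y one_pos]
      with z hz hz1 x hx
    by_contra hcon
    by_cases hb : x ∈ closedBall (0 : V) R'
    · exact hz ⟨x, ⟨hb, hcon⟩, hx⟩
    · rw [mem_closedBall_zero_iff, not_le] at hb
      have hxt : x ∉ tsupport g := fun h ↦ by
        have := mem_closedBall_zero_iff.1 (hR h)
        exact absurd (le_max_left R (‖y‖ + 1)) (by linarith)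
      rw [hout x hxt] at hx
      rw [← hx, mem_ball_iff_norm] at hz1
      have := norm_sub_norm_le x y
      exact absurd (le_max_right R (‖y‖ + 1)) (by linarith)
  have hnear : ∀ᶠ z in 𝓝 y, ∀ x ∈ S, z ∈ F '' N x :=
    (Finset.eventually_all S).2 fun x hx ↦
      (hopen₀ x ((hmem x).1 hx) _ inter_subset_left (hNo x hx)).mem_nhds
        ⟨x, hxN x hx, (hmem x).1 hx⟩
  obtain ⟨r, hr, hball⟩ := Metric.eventually_nhds_iff_ball.1 (hfar.and hnear)
  let φ : ContDiffBump y := ⟨r / 2, r, by positivity, by linarith⟩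
  have hφ0 : ∀ z, z ∉ ball y r → φ z = 0 := fun z hz ↦ by
    rwa [← φ.support_eq, Function.notMem_support] at hz
  have hφi : Integrable φ μ := φ.integrable
  have hJ := integral_comp_mul_det μ hg hgs (φ := φ) φ.contDiff φ.hasCompactSupport
  have hJi := integrable_comp_mul_det μ hg hgs (φ := φ) φ.continuous φ.hasCompactSupport
  rw [← setIntegral_eq_integral_of_forall_compl_eq_zero (s := ⋃ x ∈ S, N x) (fun x hx ↦ by
    by_cases h : F x ∈ ball y r
    · exact absurd ((hball _ h).1 x rfl) hx
    · rw [hφ0 _ h, zero_mul]),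
    integral_biUnion_finset S (fun x hx ↦ (hNo x hx).measurableSet) hdisj
      (fun x _ ↦ hJi.integrableOn)] at hJ
  have hpiece : ∀ x ∈ S, ∫ z in N x, φ (z + g z) * (1 + fderiv ℝ g z).det ∂μ
      = ((SignType.sign (fderiv ℝ F x).det : SignType) : ℝ) * ∫ z, φ z ∂μ := by
    intro x hx
    have hxy := (hmem x).1 hx
    have hcv := integral_image_eq_integral_abs_det_fderiv_smul μ (hNo x hx).measurableSet
      (fun z _ ↦ ((hF.differentiable (by simp)) z).hasFDerivAt.hasFDerivWithinAt)
      ((hinj₀ x hxy).mono inter_subset_left) φ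
    rw [setIntegral_eq_integral_of_forall_compl_eq_zero (fun z hz ↦ hφ0 z fun h ↦
      hz ((hball z h).2 x hx))] at hcv
    rw [hcv, ← integral_const_mul]
    refine setIntegral_congr_fun (hNo x hx).measurableSet fun z hz ↦ ?_
    have h1 := sign_mul_abs (fderiv ℝ F z).det
    rw [hsign₀ x hxy z hz.1] at h1
    simp only [← hFd, smul_eq_mul]
    rw [← mul_assoc, h1, mul_comm]
  rw [Finset.sum_congr rfl hpiece, ← Finset.sum_mul] at hJ
  have hpos : 0 < ∫ z, φ z ∂μ := φ.integral_pos
  refine ⟨S, hmem, odd_card_of_sum_sign_eq_one S (fun x ↦ (fderiv ℝ F x).det)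
    (fun x hx ↦ hy x ((hmem x).1 hx)) ?_⟩
  exact mul_right_cancel₀ hpos.ne' (hJ.trans (one_mul _).symm)

/-- Smoothing of a compactly supported map by an even kernel of small support. -/
theorem exists_contDiff_approx {g₀ : V → V} (hc : Continuous g₀) (hs : HasCompactSupport g₀)
    {ε δ : ℝ} (hε : 0 < ε) (hδ : 0 < δ) :
    ∃ g : V → V, ContDiff ℝ 1 g ∧ HasCompactSupport g ∧ (∀ x, ‖g x - g₀ x‖ ≤ ε) ∧
      (∀ x, (∀ z ∈ ball x δ, g₀ (-z) = g₀ z + (2 : ℝ) • z) → g (-x) = g x + (2 : ℝ) • x) ∧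
      (∀ x, (∀ z ∈ ball x δ, g₀ z = (-2 : ℝ) • z) → g x = (-2 : ℝ) • x) := by
  let _ : MeasurableSpace V := borel V
  have _ : BorelSpace V := ⟨rfl⟩
  let μ : Measure V := Measure.addHaar
  obtain ⟨η, hη, hunif⟩ := Metric.uniformContinuous_iff.1
    (hs.uniformContinuous_of_continuous hc) ε hε
  have hm : 0 < min η δ := lt_min hη hδ
  let ψ : ContDiffBump (0 : V) := ⟨min η δ / 2, min η δ, by positivity, by linarith⟩
  set ρ : V → ℝ := ψ.normed μ with hρ
  have hρc : Continuous ρ := ψ.continuous_normed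
  have hρs : HasCompactSupport ρ := ψ.hasCompactSupport_normed
  have hρ0 : ∀ t, t ∉ ball (0 : V) (min η δ) → ρ t = 0 := fun t ht ↦ by
    rw [← Function.notMem_support, ψ.support_normed_eq]
    exact ht
  have hint : ∀ h : V → V, Continuous h → Integrable (fun t ↦ ρ t • h t) μ := fun h hh ↦
    (hρc.smul hh).integrable_of_hasCompactSupport hρs.smul_right
  have : IsAddTorsionFree V := .of_isTorsionFree ℝ V
  have hmean : ∫ t, ρ t • t ∂μ = 0 := by
    have h := integral_neg_eq_self (fun t ↦ ρ t • t) μ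
    simp only [hρ, ψ.normed_neg, smul_neg, integral_neg] at h
    exact self_eq_neg.1 h.symm
  have hcenter : ∀ x, ∫ t, ρ t • (x - t) ∂μ = x := fun x ↦ by
    simp only [smul_sub]
    rw [integral_sub (hint (fun _ ↦ x) continuous_const) (hint (fun t ↦ t) continuous_id), hmean,
      sub_zero]
    exact ψ.integral_normed_smul μ x
  have hconv : ∀ x, (convolution ρ g₀ (ContinuousLinearMap.lsmul ℝ ℝ) μ) x
      = ∫ t, ρ t • g₀ (x - t) ∂μ := fun x ↦ rfl
  refine ⟨convolution ρ g₀ (ContinuousLinearMap.lsmul ℝ ℝ) μ, ?_, ?_, fun x ↦ ?_, fun x hx ↦ ?_,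
    fun x hx ↦ ?_⟩
  · exact_mod_cast hρs.contDiff_convolution_left _ (n := 1) (ψ.contDiff_normed (n := 1))
      hc.locallyIntegrable
  · exact hρs.convolution _ hs
  · rw [← dist_eq_norm]
    refine ψ.dist_normed_convolution_le hc.aestronglyMeasurable fun z hz ↦ (hunif ?_).le
    exact lt_of_lt_of_le hz (min_le_left _ _)
  · rw [hconv, hconv, ← integral_neg_eq_self]
    nth_rewrite 3 [← hcenter x]
    rw [← integral_smul]
    have hadd := integral_add (hint (fun t ↦ g₀ (x - t)) (by fun_prop))
      ((hint (fun t ↦ x - t) (by fun_prop)).smul (2 : ℝ))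
    refine Eq.trans ?_ hadd
    refine integral_congr_ae (ae_of_all _ fun t ↦ ?_)
    by_cases ht : t ∈ ball (0 : V) (min η δ)
    · have h1 := hx (x - t) (by
        rw [mem_ball_iff_norm, sub_sub_cancel_left, norm_neg]
        exact (mem_ball_zero_iff.1 ht).trans_le (min_le_right _ _))
      simp only [hρ, ψ.normed_neg]
      rw [show -x - -t = -(x - t) by abel, h1, smul_add, Pi.smul_apply, smul_comm (2 : ℝ)]
    · simp only [hρ, ψ.normed_neg]
      rw [← hρ]
      simp [hρ0 t ht]
  · rw [hconv]
    nth_rewrite 2 [← hcenter x]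
    rw [← integral_smul]
    refine integral_congr_ae (ae_of_all _ fun t ↦ ?_)
    by_cases ht : t ∈ ball (0 : V) (min η δ)
    · have h1 := hx (x - t) (by
        rw [mem_ball_iff_norm, sub_sub_cancel_left, norm_neg]
        exact (mem_ball_zero_iff.1 ht).trans_le (min_le_right _ _))
      simp only
      rw [h1, smul_comm]
    · simp [hρ0 t ht]

theorem exists_pos_le_norm_of_ne_zero {f : V → V} (hf : Continuous f) {R s : ℝ} (hs : 0 < s)
    (hR : ∀ x, R ≤ ‖x‖ → f x = x) (h0 : ∀ x, s ≤ ‖x‖ → f x ≠ 0) :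
    ∃ c > 0, ∀ x, s ≤ ‖x‖ → c ≤ ‖f x‖ := by
  have hC : IsCompact (f '' (closedBall 0 R \ ball 0 s)) :=
    ((isCompact_closedBall _ _).diff isOpen_ball).image hf
  have h : (0 : V) ∉ f '' (closedBall 0 R \ ball 0 s) := by
    rintro ⟨x, hx, hx0⟩
    exact h0 x (by simpa using hx.2) hx0
  obtain ⟨c, hc, hball⟩ := Metric.mem_nhds_iff.1 (hC.isClosed.isOpen_compl.mem_nhds h)
  refine ⟨min c s, lt_min hc hs, fun x hx ↦ ?_⟩
  by_cases hxR : ‖x‖ ≤ R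
  · refine (min_le_left _ _).trans ?_
    by_contra! hlt
    exact hball (mem_ball_zero_iff.2 hlt) ⟨x, ⟨by simpa using hxR, by simpa using hx⟩, rfl⟩
  · rw [hR x (not_le.1 hxR).le]
    exact (min_le_right _ _).trans hx

theorem continuous_radial_combination {V : Type*} [NormedAddCommGroup V]
    [NormedSpace ℝ V] {M : V → V} (hM : ContinuousOn M {0}ᶜ) {a b : ℝ → ℝ}
    (ha : Continuous a) (hb : Continuous b) (hb0 : ∀ r ≤ 1, b r = 0) :
    Continuous fun x ↦ a ‖x‖ • x + b ‖x‖ • M x := by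
  refine ((ha.comp continuous_norm).smul continuous_id).add ?_
  rw [continuous_iff_continuousAt]
  intro x
  by_cases hx : x = 0
  · subst hx
    refine (continuousAt_const (y := (0 : V))).congr ?_
    filter_upwards [ball_mem_nhds (0 : V) one_pos] with z hz
    rw [hb0 _ (mem_ball_zero_iff.1 hz).le, zero_smul]
  · exact (hb.comp continuous_norm).continuousAt.smul
      (hM.continuousAt (isOpen_compl_singleton.mem_nhds hx))

theorem radial_combination_ne_zero {V : Type*} [NormedAddCommGroup V]
    [NormedSpace ℝ V] {M : V → V} (h : ∀ x, x ≠ 0 → ∀ t : ℝ, M x ≠ t • x)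
    {α β : ℝ} (hαβ : α ≠ 0 ∨ β ≠ 0) {x : V} (hx : x ≠ 0) : α • x + β • M x ≠ 0 := by
  intro h0
  by_cases hβ : β = 0
  · subst hβ
    simp only [zero_smul, add_zero, smul_eq_zero] at h0
    exact hαβ.elim (fun hα ↦ h0.elim hα hx) (fun h ↦ h rfl)
  · refine h x hx (-(β⁻¹ * α)) ?_
    rw [neg_smul, mul_smul, ← smul_neg, ← eq_neg_of_add_eq_zero_right h0, inv_smul_smul₀ hβ]

/-- A field that is even and continuous away from the origin is radial somewhere. -/
theorem exists_eq_smul_of_even [Nontrivial V] {M : V → V} (hM : ContinuousOn M {0}ᶜ)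
    (heven : ∀ x, M (-x) = M x) : ∃ x ≠ 0, ∃ t : ℝ, M x = t • x := by
  classical
  by_contra! hcon
  let _ : MeasurableSpace V := borel V
  have _ : BorelSpace V := ⟨rfl⟩
  let μ : Measure V := Measure.addHaar
  set a : ℝ → ℝ := fun r ↦ max 0 (min 1 (r - 2)) with ha
  set b : ℝ → ℝ := fun r ↦ max 0 ((r - 1) * (3 - r)) with hb
  have ha2 : ∀ r ≤ 2, a r = 0 := fun r hr ↦
    max_eq_left ((min_le_right _ _).trans (by linarith))
  have ha3 : ∀ r, 3 ≤ r → a r = 1 := fun r hr ↦ by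
    simp only [ha]
    rw [min_eq_left (by linarith), max_eq_right zero_le_one]
  have hb1 : ∀ r ≤ 1, b r = 0 := fun r hr ↦ max_eq_left (by nlinarith)
  have hb3 : ∀ r, 3 ≤ r → b r = 0 := fun r hr ↦ max_eq_left (by nlinarith)
  have hb13 : ∀ r, 1 < r → r < 3 → b r ≠ 0 := fun r h1 h3 ↦
    (lt_max_of_lt_right (mul_pos (by linarith) (by linarith))).ne'
  set f : V → V := fun x ↦ a ‖x‖ • x + b ‖x‖ • M x with hf
  have hfc : Continuous f := continuous_radial_combination hM (by fun_prop) (by fun_prop) hb1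
  have hfR : ∀ x, 3 ≤ ‖x‖ → f x = x := fun x hx ↦ by simp [hf, ha3 _ hx, hb3 _ hx]
  have hf0 : ∀ x, 3 / 2 ≤ ‖x‖ → f x ≠ 0 := fun x hx ↦ by
    refine radial_combination_ne_zero hcon ?_ (norm_pos_iff.1 (by linarith))
    by_cases h : 3 ≤ ‖x‖
    · exact Or.inl (by rw [ha3 _ h]; exact one_ne_zero)
    · exact Or.inr (hb13 _ (by linarith) (not_le.1 h))
  obtain ⟨c, hc, hfle⟩ := exists_pos_le_norm_of_ne_zero hfc (by norm_num) hfR hf0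
  have hg₀s : HasCompactSupport fun x ↦ f x - x :=
    HasCompactSupport.intro (isCompact_closedBall 0 3) fun x hx ↦ by
      rw [mem_closedBall_zero_iff, not_le] at hx
      rw [hfR x hx.le, sub_self]
  have hg₀c : Continuous fun x ↦ f x - x := hfc.sub continuous_id
  obtain ⟨g, hg, hgs, hgε, hgeven, -⟩ := exists_contDiff_approx hg₀c hg₀s
    (half_pos hc) (one_half_pos (α := ℝ))
  have hnorm : ∀ x, 3 / 2 ≤ ‖x‖ → c / 2 ≤ ‖x + g x‖ := fun x hx ↦ by
    have h1 := hfle x hx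
    have h2 := hgε x
    have h3 := norm_sub_norm_le (f x) (x + g x)
    rw [norm_sub_rev, show x + g x - f x = g x - (f x - x) by abel] at h3
    linarith
  have heven' : ∀ x, ‖x‖ < 3 / 2 → -x + g (-x) = x + g x := fun x hx ↦ by
    rw [hgeven x fun z hz ↦ ?_, two_smul]
    · abel
    · have hz2 : ‖z‖ ≤ 2 := by
        have h1 := norm_sub_norm_le z x
        have h2 := mem_ball_iff_norm.1 hz
        linarith
      simp only [hf, norm_neg, ha2 _ hz2, heven]
      module
  have hFd : ∀ x, HasFDerivAt (fun x ↦ x + g x) (1 + fderiv ℝ g x) x := fun x ↦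
    (hasFDerivAt_id x).add ((hg.differentiable (by simp)) x).hasFDerivAt
  have hsard := addHaar_image_eq_zero_of_det_fderivWithin_eq_zero μ
    (s := {x | (1 + fderiv ℝ g x).det = 0}) (fun x _ ↦ (hFd x).hasFDerivWithinAt) fun x hx ↦ hx
  obtain ⟨y, hyball, hy⟩ : ∃ y ∈ ball (0 : V) (c / 2),
      y ∉ (fun x ↦ x + g x) '' {x | (1 + fderiv ℝ g x).det = 0} ∪ {0 + g 0} := by
    by_contra! hsub
    have h1 : μ (ball (0 : V) (c / 2)) = 0 :=
      measure_mono_null (fun y hy ↦ hsub y hy) (measure_union_null hsard (measure_singleton _))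
    exact (measure_ball_pos μ 0 (half_pos hc)).ne' h1
  rw [mem_union, not_or] at hy
  obtain ⟨S, hS, hodd⟩ := exists_finset_fiber_odd_card hg hgs (y := y)
    fun x hx h0 ↦ hy.1 ⟨x, h0, hx⟩
  have hsmall : ∀ x ∈ S, ‖x‖ < 3 / 2 := fun x hx ↦ by
    by_contra! h
    have := hnorm x h
    rw [(hS x).1 hx] at this
    exact absurd (mem_ball_zero_iff.1 hyball) (not_lt.2 this)
  have hsum : ∑ _x ∈ S, (1 : ZMod 2) = 0 := by
    refine Finset.sum_involution (fun x _ ↦ -x) (fun _ _ ↦ by decide) (fun x hx _ hneg ↦ ?_)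
      (fun x hx ↦ ?_) (fun x _ ↦ neg_neg x)
    · have : IsAddTorsionFree V := .of_isTorsionFree ℝ V
      have hx0 : x = 0 := neg_eq_self.1 hneg
      subst hx0
      exact hy.2 ((hS 0).1 hx).symm
    · rw [hS, heven' x (hsmall x hx)]
      exact (hS x).1 hx
  rw [Finset.sum_const, nsmul_one, (ZMod.natCast_eq_one_iff_odd).2 hodd] at hsum
  exact one_ne_zero hsum

/-- In odd dimension a field that is continuous away from the origin is radial somewhere. -/
theorem exists_eq_smul_of_odd_finrank (hodd : Odd (Module.finrank ℝ V)) {M : V → V}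
    (hM : ContinuousOn M {0}ᶜ) : ∃ x ≠ 0, ∃ t : ℝ, M x = t • x := by
  by_contra! hcon
  let _ : MeasurableSpace V := borel V
  have _ : BorelSpace V := ⟨rfl⟩
  let μ : Measure V := Measure.addHaar
  set a : ℝ → ℝ := fun r ↦ max (-1) (min 1 (2 * r - 3)) with ha
  set b : ℝ → ℝ := fun r ↦ max 0 ((r - 1) * (2 - r)) with hb
  have ha1 : ∀ r ≤ 1, a r = -1 := fun r hr ↦
    max_eq_left ((min_le_right _ _).trans (by linarith))
  have ha2 : ∀ r, 2 ≤ r → a r = 1 := fun r hr ↦ by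
    simp only [ha]
    rw [min_eq_left (by linarith), max_eq_right (by norm_num)]
  have hb1 : ∀ r ≤ 1, b r = 0 := fun r hr ↦ max_eq_left (by nlinarith)
  have hb2 : ∀ r, 2 ≤ r → b r = 0 := fun r hr ↦ max_eq_left (by nlinarith)
  have hb12 : ∀ r, 1 < r → r < 2 → b r ≠ 0 := fun r h1 h2 ↦
    (lt_max_of_lt_right (mul_pos (by linarith) (by linarith))).ne'
  set f : V → V := fun x ↦ a ‖x‖ • x + b ‖x‖ • M x with hf
  have hfc : Continuous f := continuous_radial_combination hM (by fun_prop) (by fun_prop) hb1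
  have hfR : ∀ x, 2 ≤ ‖x‖ → f x = x := fun x hx ↦ by simp [hf, ha2 _ hx, hb2 _ hx]
  have hf0 : ∀ x, 1 / 2 ≤ ‖x‖ → f x ≠ 0 := fun x hx ↦ by
    refine radial_combination_ne_zero hcon ?_ (norm_pos_iff.1 (by linarith))
    by_cases h : ‖x‖ ≤ 1
    · exact Or.inl (by rw [ha1 _ h]; norm_num)
    by_cases h' : 2 ≤ ‖x‖
    · exact Or.inl (by rw [ha2 _ h']; exact one_ne_zero)
    · exact Or.inr (hb12 _ (not_le.1 h) (not_le.1 h'))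
  obtain ⟨c, hc, hfle⟩ := exists_pos_le_norm_of_ne_zero hfc (by norm_num) hfR hf0
  have hg₀s : HasCompactSupport fun x ↦ f x - x :=
    HasCompactSupport.intro (isCompact_closedBall 0 2) fun x hx ↦ by
      rw [mem_closedBall_zero_iff, not_le] at hx
      rw [hfR x hx.le, sub_self]
  have hg₀c : Continuous fun x ↦ f x - x := hfc.sub continuous_id
  obtain ⟨g, hg, hgs, hgε, -, hgneg⟩ := exists_contDiff_approx hg₀c hg₀s
    (half_pos hc) (one_half_pos (α := ℝ))
  have hnorm : ∀ x, 1 / 2 ≤ ‖x‖ → c / 2 ≤ ‖x + g x‖ := fun x hx ↦ by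
    have h1 := hfle x hx
    have h2 := hgε x
    have h3 := norm_sub_norm_le (f x) (x + g x)
    rw [norm_sub_rev, show x + g x - f x = g x - (f x - x) by abel] at h3
    linarith
  have hgneg' : ∀ x ∈ ball (0 : V) (1 / 2), g x = (-2 : ℝ) • x := fun x hx ↦ by
    refine hgneg x fun z hz ↦ ?_
    have hz1 : ‖z‖ ≤ 1 := by
      have h1 := norm_sub_norm_le z x
      have h2 := mem_ball_iff_norm.1 hz
      have h3 := mem_ball_zero_iff.1 hx
      linarith
    simp only [hf, ha1 _ hz1, hb1 _ hz1]
    module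
  have hdet : ∀ x ∈ ball (0 : V) (1 / 2), (1 + fderiv ℝ g x).det = -1 := fun x hx ↦ by
    have h1 : g =ᶠ[𝓝 x] fun x ↦ (-2 : ℝ) • x :=
      Filter.eventuallyEq_of_mem (isOpen_ball.mem_nhds hx) hgneg'
    have h2 : fderiv ℝ g x = (-2 : ℝ) • (1 : V →L[ℝ] V) := by
      rw [h1.fderiv_eq]
      exact ((hasFDerivAt_id x).const_smul (-2 : ℝ)).fderiv
    have h3 : (1 : V →L[ℝ] V) + (-2 : ℝ) • (1 : V →L[ℝ] V) = (-1 : ℝ) • (1 : V →L[ℝ] V) := by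
      module
    rw [h2, h3]
    have h4 := LinearMap.det_smul (-1 : ℝ) (1 : V →ₗ[ℝ] V)
    rw [hodd.neg_one_pow, map_one, mul_one] at h4
    exact h4
  have hr : 0 < min (c / 2) (1 / 2) := lt_min (half_pos hc) one_half_pos
  let φ : ContDiffBump (0 : V) :=
    ⟨min (c / 2) (1 / 2) / 2, min (c / 2) (1 / 2), by positivity, by linarith⟩
  have hφ0 : ∀ z, min (c / 2) (1 / 2) ≤ ‖z‖ → φ z = 0 := fun z hz ↦ by
    rw [← Function.notMem_support, φ.support_eq]
    exact fun h ↦ absurd (mem_ball_zero_iff.1 h) (not_lt.2 hz)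
  have hJ := integral_comp_mul_det μ hg hgs (φ := φ) φ.contDiff φ.hasCompactSupport
  have hpt : ∀ x, φ (x + g x) * (1 + fderiv ℝ g x).det = -φ x := fun x ↦ by
    by_cases hx : x ∈ ball (0 : V) (1 / 2)
    · rw [hdet x hx, hgneg' x hx, show x + (-2 : ℝ) • x = -x by module, φ.neg, mul_neg_one]
    · rw [mem_ball_zero_iff, not_lt] at hx
      rw [hφ0 _ ((min_le_left _ _).trans (hnorm x hx)), hφ0 _ ((min_le_right _ _).trans hx)]
      simp
  simp only [hpt, integral_neg] at hJ
  have hpos : 0 < ∫ z, φ z ∂μ := φ.integral_pos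
  linarith

end Degree

section LieExp

variable {E : Type*} [NormedAddCommGroup E] [NormedSpace ℝ E] [FiniteDimensional ℝ E]
  {H : Type*} [TopologicalSpace H] {I : ModelWithCorners ℝ E H}
  {G : Type*} [TopologicalSpace G] [ChartedSpace H G] [Group G] [BoundarylessManifold I G]
  [LieGroup I ∞ G]

theorem oneParam_zero (v : GroupLieAlgebra I G) : oneParam v 0 = 1 :=
  (Classical.choose_spec (exists_oneParam v)).1

theorem isMIntegralCurve_oneParam (v : GroupLieAlgebra I G) :
    IsMIntegralCurve (oneParam v) (mulInvariantVectorField v) :=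
  (Classical.choose_spec (exists_oneParam v)).2

theorem lieExp_smul (a : ℝ) (v : GroupLieAlgebra I G) : lieExp (a • v) = oneParam v a := by
  have h := (isMIntegralCurve_oneParam v).comp_mul a
  have hv : a • mulInvariantVectorField v
      = (mulInvariantVectorField (a • v) : ∀ g : G, TangentSpace I g) := by
    ext g
    exact ((mfderiv I I (g * ·) (1 : G)).map_smul a v).symm
  rw [hv] at h
  have h1 := eq_oneParam (by simp [oneParam_zero]) h
  have h2 := congrFun h1 1
  simpa [lieExp] using h2.symm

theorem lieExp_mul_lieExp_neg (v : GroupLieAlgebra I G) : lieExp v * lieExp (-v) = 1 := by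
  have h1 := (isMIntegralCurve_oneParam (-v)).comp_add (-1)
  have h2 : IsMIntegralCurve
      (fun t ↦ (oneParam (-v) (-1))⁻¹ * oneParam (-v) (t + -1)) (mulInvariantVectorField (-v)) :=
    isMIntegralCurve_iff_isMIntegralCurveOn.2 (isMIntegralCurveOn_const_mul
      (isMIntegralCurve_iff_isMIntegralCurveOn.1 h1) _)
  have h3 := congrFun (eq_oneParam (by simp) h2) 1
  simp only [add_neg_cancel, oneParam_zero, mul_one] at h3
  have h4 := lieExp_smul (-1) (-v)
  rw [neg_one_smul, neg_neg] at h4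
  rw [h4, lieExp, ← h3, mul_inv_cancel]

theorem one_mem_unorientedUnderlying {σ : C(ℙ ℝ (GroupLieAlgebra I G), G)}
    {μ : C(ℙ ℝ (GroupLieAlgebra I G), GroupLieAlgebra I G)} (hμ : ∀ L, lieExp (μ L) = σ L)
    {L : ℙ ℝ (GroupLieAlgebra I G)} (hL : μ L ∈ L.submodule) :
    (1 : G) ∈ unorientedUnderlying σ :=
  mem_iUnion.2 ⟨L, -μ L, neg_mem hL, by rw [← hμ]; exact lieExp_mul_lieExp_neg _⟩

theorem one_mem_orientedUnderlying {B : LinearMap.BilinForm ℝ (GroupLieAlgebra I G)}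
    {σ : C(unitSphere B, G)} {μ : C(unitSphere B, GroupLieAlgebra I G)}
    (hμ : ∀ x, lieExp (μ x) = σ x) {x : unitSphere B} {t : ℝ}
    (hx : μ x = t • (x : GroupLieAlgebra I G)) : (1 : G) ∈ orientedUnderlying σ := by
  refine mem_iUnion.2 ⟨x, -t, ?_⟩
  simp only
  rw [← hμ, neg_smul, ← hx]
  exact lieExp_mul_lieExp_neg _

end LieExp

section VectorSpace

variable {V : Type*} [NormedAddCommGroup V] [NormedSpace ℝ V] [FiniteDimensional ℝ V]

theorem exists_mem_submodule_of_continuous [Nontrivial V] (μ : C(ℙ ℝ V, V)) :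
    ∃ L : ℙ ℝ V, μ L ∈ L.submodule := by
  classical
  let M : V → V := fun x ↦ if hx : x = 0 then 0 else μ (Projectivization.mk ℝ x hx)
  have hM : ∀ x (hx : x ≠ 0), M x = μ (Projectivization.mk ℝ x hx) := fun x hx ↦ dif_neg hx
  have hcont : ContinuousOn M {0}ᶜ := by
    rw [continuousOn_iff_continuous_domRestrict]
    have hmk : Continuous fun x : {v : V // v ≠ 0} ↦ Projectivization.mk ℝ x.1 x.2 :=
      continuous_quotient_mk'
    refine (μ.continuous.comp hmk).congr fun x ↦ ?_
    exact (hM x.1 x.2).symm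
  have heven : ∀ x, M (-x) = M x := fun x ↦ by
    by_cases hx : x = 0
    · rw [hx, neg_zero]
    · rw [hM x hx, hM (-x) (neg_ne_zero.2 hx)]
      congr 1
      rw [Projectivization.mk_eq_mk_iff']
      exact ⟨-1, by simp⟩
  obtain ⟨x, hx, t, ht⟩ := exists_eq_smul_of_even hcont heven
  refine ⟨Projectivization.mk ℝ x hx, ?_⟩
  rw [← hM x hx, ht, Projectivization.submodule_mk]
  exact Submodule.smul_mem _ _ (Submodule.mem_span_singleton_self x)

theorem exists_eq_smul_of_continuous_unitSphere (hodd : Odd (Module.finrank ℝ V))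
    (B : LinearMap.BilinForm ℝ V) (hB : ∀ x, x ≠ 0 → 0 < B x x)
    (μ : C({x : V | B x x = 1}, V)) : ∃ x, ∃ t : ℝ, μ x = t • (x : V) := by
  classical
  have hBc : Continuous fun x ↦ B x x := by
    have h : Continuous fun x ↦ LinearMap.toContinuousLinearMap (B x) :=
      ((LinearMap.toContinuousLinearMap (𝕜 := ℝ) (E := V) (F' := ℝ)).toLinearMap.comp
        B).continuous_of_finiteDimensional
    exact h.clm_apply continuous_id
  have hs : ∀ x, x ≠ 0 → 0 < (√(B x x))⁻¹ := fun x hx ↦ inv_pos.2 (Real.sqrt_pos.2 (hB x hx))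
  have hunit : ∀ x, x ≠ 0 → (√(B x x))⁻¹ • x ∈ {x : V | B x x = 1} := fun x hx ↦ by
    have h := Real.mul_self_sqrt (hB x hx).le
    have h0 := (Real.sqrt_pos.2 (hB x hx)).ne'
    simp only [mem_ofPred_eq, map_smul, LinearMap.smul_apply, smul_eq_mul]
    nth_rewrite 3 [← h]
    field_simp
  let M : V → V := fun x ↦ if hx : x ≠ 0 then μ ⟨(√(B x x))⁻¹ • x, hunit x hx⟩ else 0
  have hM : ∀ x (hx : x ≠ 0), M x = μ ⟨(√(B x x))⁻¹ • x, hunit x hx⟩ := fun x hx ↦ dif_pos hx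
  have hcont : ContinuousOn M {0}ᶜ := by
    rw [continuousOn_iff_continuous_domRestrict]
    have hn : Continuous fun x : ({0}ᶜ : Set V) ↦
        (⟨(√(B x.1 x.1))⁻¹ • x.1, hunit x.1 x.2⟩ : {x : V | B x x = 1}) := by
      refine Continuous.subtype_mk (Continuous.smul (Continuous.inv₀ ?_ fun x ↦ ?_)
        continuous_subtype_val) _
      · exact (Real.continuous_sqrt.comp hBc).comp continuous_subtype_val
      · exact (Real.sqrt_pos.2 (hB x.1 x.2)).ne'
    refine (μ.continuous.comp hn).congr fun x ↦ ?_
    exact (hM x.1 x.2).symm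
  obtain ⟨x, hx, t, ht⟩ := exists_eq_smul_of_odd_finrank hodd hcont
  refine ⟨⟨(√(B x x))⁻¹ • x, hunit x hx⟩, t * √(B x x), ?_⟩
  rw [← hM x hx, ht, smul_smul, mul_assoc, mul_inv_cancel₀ (inv_pos.1 (hs x hx)).ne', mul_one]

end VectorSpace

end Kakeya

theorem mainTheorem3 {E : Type*} [NormedAddCommGroup E] [NormedSpace ℝ E] [FiniteDimensional ℝ E]
    {H : Type*} [TopologicalSpace H] (I : ModelWithCorners ℝ E H)
    (G : Type*) [TopologicalSpace G] [ChartedSpace H G] [Group G] [BoundarylessManifold I G]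
    [LieGroup I ∞ G] [ConnectedSpace G] :
    (0 < Module.finrank ℝ (GroupLieAlgebra I G) →
      ∀ σ : C(ℙ ℝ (GroupLieAlgebra I G), G), Kakeya.IsLinearUnoriented σ →
        (1 : G) ∈ Kakeya.unorientedUnderlying σ) ∧
    (Odd (Module.finrank ℝ (GroupLieAlgebra I G)) →
      ∀ B : LinearMap.BilinForm ℝ (GroupLieAlgebra I G), B.IsSymm → (∀ x, x ≠ 0 → 0 < B x x) →
        ∀ σ : C(Kakeya.unitSphere B, G), Kakeya.IsLinearOriented σ →
          (1 : G) ∈ Kakeya.orientedUnderlying σ) := by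
  refine ⟨fun hdim σ ⟨μ, hμ⟩ ↦ ?_, fun hodd B _ hB σ ⟨μ, hμ⟩ ↦ ?_⟩
  · have hE : 0 < Module.finrank ℝ E := hdim
    have : Nontrivial E := (Module.finrank_pos_iff (R := ℝ)).1 hE
    obtain ⟨L, hL⟩ := Kakeya.exists_mem_submodule_of_continuous (V := E) μ
    exact Kakeya.one_mem_unorientedUnderlying hμ hL
  · obtain ⟨x, t, hx⟩ := Kakeya.exists_eq_smul_of_continuous_unitSphere (V := E) hodd B hB μ
    exact Kakeya.one_mem_orientedUnderlying hμ hx
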